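/- Let $\mathcal M$ be a von Neumann algebra with a normal faithful finite trace $\tau$, let $d\ge 1$, and let $\mathbf T=(T_1,\dots,T_d)$ be mutually commuting normal trace preserving $*$-automorphisms of $\mathcal M$. Let $L_2(\mathcal M)$ be the noncommutative $L_2$-space of $(\mathcal M,\tau)$, that is, the Hilbert space completion of $\mathcal M$ for the inner product $(a,b)\mapsto\tau(a^*b)$, and denote the unitary extension of $T_j$ to $L_2(\mathcal M)$ again by $T_j$. For $\mathbf m\in\mathbb Z^d$ and $\mathbf z$ in the torus $\mathbb T^d=\{\mathbf z\in\mathbb C^d:|z_1|=\dots=|z_d|=1\}$ write $\mathbf T^{\mathbf m}=T_1^{m_1}\cdots T_d^{m_d}$ and $\mathbf z^{\mathbf m}=z_1^{m_1}\cdots z_d^{m_d}$. Let $$E_j=\{x\in L_2(\mathcal M): T_jx=\mu x\text{ for some }\mu\in\mathbb C,\ |\mu|=1\},\qquad j=1,\dots,d,$$ and let the Kronecker factor $\mathcal K$ be the $\|\cdot\|_2$-closure of the linear span of $\bigcap_{j=1}^dE_j$. If $x\in L_2(\mathcal M)$ is orthogonal to $\mathcal K$, then the spectral measure $\sigma_x$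 of $x$, that is, the unique finite positive Borel measure on $\mathbb T^d$ with $$\int_{\mathbb T^d}\mathbf z^{\mathbf m}\,d\sigma_x(\mathbf z)=\tau\big((\mathbf T^{\mathbf m}x)^*x\big)\qquad\text{for all }\mathbf m\in\mathbb Z^d,$$ exists and is continuous: $\sigma_x(\{\mathbf z\})=0$ for every $\mathbf z\in\mathbb T^d$. (For $x,y\in L_2(\mathcal M)$, $\tau(y^*x)$ denotes the inner product, conjugate linear in $y$, that extends $\tau(b^*a)$, $a,b\in\mathcal M$.) -/

import Mathlib

open MeasureTheory
open scoped ComplexOrder InnerProductSpace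

/-- The circle carries its Borel `σ`-algebra; the torus `Fin d → Circle` then carries the product
`σ`-algebra, which is its Borel `σ`-algebra. -/
noncomputable instance instMeasurableSpaceCircleBorel : MeasurableSpace Circle := borel Circle

instance instBorelSpaceCircleBorel : BorelSpace Circle := ⟨rfl⟩

theorem borelSpace_torus (d : ℕ) : BorelSpace (Fin d → Circle) := inferInstance

/-- A finite trace preserving dynamical system `(M, τ, T)`: a normal faithful finite trace `τ` on
the von Neumann algebra `M`, and `d` mutually commuting normal trace preserving
`*`-automorphisms `T 0, …, T (d - 1)` of `M`. -/
structure TracePreservingSystem (M : Type*) [CStarAlgebra M] [PartialOrder M] [StarOrderedRing M]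
    [WStarAlgebra M] (d : ℕ) where
  /-- The trace, a positive linear functional defined on all of `M`. -/
  τ : M →ₚ[ℂ] ℂ
  τ_mul_comm : ∀ a b : M, τ (a * b) = τ (b * a)
  τ_faithful : ∀ a : M, τ (star a * a) = 0 → a = 0
  /-- `τ` is normal: it preserves suprema of increasing families of positive elements. -/
  τ_normal : ∀ (s : Set M) (b : M), s.Nonempty → DirectedOn (· ≤ ·) s → (∀ a ∈ s, 0 ≤ a) →
    IsLUB s b → IsLUB (τ '' s) (τ b)
  /-- The automorphisms. -/
  T : Fin d → (M ≃⋆ₐ[ℂ] M)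
  T_comm : ∀ (i j : Fin d) (a : M), T i (T j a) = T j (T i a)
  T_trace : ∀ (j : Fin d) (a : M), τ (T j a) = τ a
  /-- Each `T j` is normal. -/
  T_normal : ∀ (j : Fin d) (s : Set M) (b : M), s.Nonempty → DirectedOn (· ≤ ·) s →
    (∀ a ∈ s, 0 ≤ a) → IsLUB s b → IsLUB (T j '' s) (T j b)

namespace TracePreservingSystem

variable {M : Type*} [CStarAlgebra M] [PartialOrder M] [StarOrderedRing M] [WStarAlgebra M]
  {d : ℕ} (S : TracePreservingSystem M d)

/-- The Hilbert space `L₂(M, τ)`: the completion of `M` for the inner product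
`⟪a, b⟫ = τ (a* b)`, that is, for the norm `‖a‖₂ = τ (a* a) ^ (1 / 2)`. -/
abbrev L2 : Type _ := S.τ.GNS

/-- The canonical embedding of `M` into `L₂(M, τ)`. -/
noncomputable def toL2 (a : M) : S.L2 := ((S.τ.toPreGNS a : S.τ.PreGNS) : S.τ.GNS)

theorem inner_toL2 (a b : M) : ⟪S.toL2 a, S.toL2 b⟫_ℂ = S.τ (star a * b) := by
  simp [toL2, PositiveLinearMap.preGNS_inner_def]

theorem denseRange_toL2 : DenseRange S.toL2 :=
  UniformSpace.Completion.denseRange_coe (α := S.τ.PreGNS)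

theorem T_symm_trace (j : Fin d) (a : M) : S.τ ((S.T j).symm a) = S.τ a := by
  rw [← S.T_trace j ((S.T j).symm a), StarAlgEquiv.apply_symm_apply]

/-- A trace preserving `*`-automorphism `θ` of `M`, as a linear isometry of `M` for the norm
`‖·‖₂`. -/
noncomputable def preIsometry (θ : M ≃⋆ₐ[ℂ] M) (h : ∀ a, S.τ (θ a) = S.τ a) :
    S.τ.PreGNS →ₗᵢ[ℂ] S.τ.PreGNS where
  toFun a := S.τ.toPreGNS (θ (S.τ.ofPreGNS a))
  map_add' := by simp
  map_smul' := by simp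
  norm_map' a := by
    simp only [PositiveLinearMap.preGNS_norm_def]
    congr 2
    change S.τ (star (θ (S.τ.ofPreGNS a)) * θ (S.τ.ofPreGNS a)) = _
    rw [← map_star, ← map_mul, h]

/-- The continuous extension of a trace preserving `*`-automorphism of `M` to `L₂(M, τ)`. -/
noncomputable def extend (θ : M ≃⋆ₐ[ℂ] M) (h : ∀ a, S.τ (θ a) = S.τ a) : S.L2 →L[ℂ] S.L2 :=
  (S.preIsometry θ h).toContinuousLinearMap.completion

theorem extend_toL2 (θ : M ≃⋆ₐ[ℂ] M) (h : ∀ a, S.τ (θ a) = S.τ a) (a : M) :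
    S.extend θ h (S.toL2 a) = S.toL2 (θ a) := by
  simp [extend, toL2, preIsometry]

theorem extend_extend (θ η : M ≃⋆ₐ[ℂ] M) (h : ∀ a, S.τ (θ a) = S.τ a)
    (h' : ∀ a, S.τ (η a) = S.τ a) (hθη : ∀ a, θ (η a) = a) (x : S.L2) :
    S.extend θ h (S.extend η h' x) = x := by
  refine S.denseRange_toL2.induction_on x (isClosed_eq (by fun_prop) continuous_id) fun a ↦ ?_
  rw [extend_toL2, extend_toL2, hθη]

theorem norm_extend (θ : M ≃⋆ₐ[ℂ] M) (h : ∀ a, S.τ (θ a) = S.τ a) (x : S.L2) :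
    ‖S.extend θ h x‖ = ‖x‖ := by
  refine S.denseRange_toL2.induction_on x (isClosed_eq (by fun_prop) continuous_norm) fun a ↦ ?_
  rw [extend_toL2]
  have h1 : ∀ b : M, ‖S.toL2 b‖ = ‖S.τ.toPreGNS b‖ := fun b ↦
    UniformSpace.Completion.norm_coe _
  rw [h1, h1]
  exact (S.preIsometry θ h).norm_map (S.τ.toPreGNS a)

/-- The unitary operator on `L₂(M, τ)` that extends the automorphism `T j` of `M`. -/
noncomputable def U (j : Fin d) : S.L2 ≃ₗᵢ[ℂ] S.L2 where
  toFun := S.extend (S.T j) (S.T_trace j)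
  invFun := S.extend (S.T j).symm (S.T_symm_trace j)
  map_add' := map_add _
  map_smul' := map_smul _
  left_inv := S.extend_extend _ _ _ _ fun a ↦ (S.T j).symm_apply_apply a
  right_inv := S.extend_extend _ _ _ _ fun a ↦ (S.T j).apply_symm_apply a
  norm_map' := S.norm_extend _ _

theorem U_toL2 (j : Fin d) (a : M) : S.U j (S.toL2 a) = S.toL2 (S.T j a) :=
  S.extend_toL2 _ _ a

/-- `T ^ m = T₁ ^ m₁ ⋯ T_d ^ m_d` on `L₂(M, τ)`, for a multi-index `m ∈ ℤ ^ d`; the product is that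
of the group of unitary operators, i.e. composition. -/
noncomputable def Upow (m : Fin d → ℤ) : S.L2 ≃ₗᵢ[ℂ] S.L2 :=
  (List.ofFn fun j ↦ S.U j ^ m j).prod

/-- `E_j`: the vectors `x ∈ L₂(M, τ)` such that `T_j x = μ x` for some `μ` in the circle. -/
def eigenvectors (j : Fin d) : Set S.L2 :=
  {x | ∃ μ : Circle, S.U j x = (μ : ℂ) • x}

/-- The Kronecker factor: the `‖·‖₂`-closure of the linear span of the joint eigenvectors. -/
noncomputable def kronecker : Submodule ℂ S.L2 :=
  (Submodule.span ℂ (⋂ j, S.eigenvectors j)).topologicalClosure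

/-- The correlation `γ_x(m) = τ ((T ^ m x)* x) = (T ^ m x, x)` of `x ∈ L₂(M, τ)`; recall that
the inner product is conjugate linear in its first argument. -/
noncomputable def correlation (x : S.L2) (m : Fin d → ℤ) : ℂ :=
  ⟪S.Upow m x, x⟫_ℂ

/-- `σ` is a spectral measure of `x`: a finite positive Borel measure on the torus `𝕋 ^ d` with
`∫ z ^ m dσ(z) = γ_x(m)` for every `m ∈ ℤ ^ d`. -/
structure IsSpectralMeasure (x : S.L2) (σ : Measure (Fin d → Circle)) : Prop where
  finite : IsFiniteMeasure σ
  fourier : ∀ m : Fin d → ℤ,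
    ∫ z : Fin d → Circle, ∏ j, (z j : ℂ) ^ m j ∂σ = S.correlation x m

end TracePreservingSystem

/-! The commuting unitaries `S.U j` have a joint continuous functional calculus, a representation
`π` of C(𝕋^d) on `S.L2`. Riesz representation turns the vector state of `x` under `π` into the
spectral measure `σ`; Stone–Weierstrass makes it unique. The mass of a point z is found by testing
against powers of a continuous g with g(z) = 1 and 0 < g < 1 elsewhere. As gⁿ decreases to the
indicator of {z}, the vectors π(gⁿ)x converge to some y (possibly 0), the spectral projection of {z}
applied to x. Then π(h)y = h(z)y for all h, so y is a joint eigenvector in the Kronecker factor, and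
⟪x, y⟫ = σ{z}. Orthogonality of x to that factor gives σ{z} = 0. -/

open Filter Topology

/-! ### Joint functional calculus via Gelfand duality -/

/-- The joint continuous functional calculus of a commuting family of unitaries. -/
theorem exists_starAlgHom_of_commute_unitary {A : Type*} [CStarAlgebra A] {ι : Type*}
    (a : ι → unitary A) (ha : ∀ i j, Commute (a i) (a j)) :
    ∃ π : C(ι → Circle, ℂ) →⋆ₐ[ℂ] A,
      ∀ j, π ⟨fun z ↦ (z j : ℂ), by fun_prop⟩ = a j := by
  let s : Set A := Set.range fun j ↦ (a j : A)
  have hcomm : ∀ x ∈ s, ∀ y ∈ s, x * y = y * x := by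
    rintro _ ⟨i, rfl⟩ _ ⟨j, rfl⟩
    exact congrArg Subtype.val (ha i j)
  have hcomm_star : ∀ x ∈ s, ∀ y ∈ s, x * star y = star y * x := by
    rintro _ ⟨i, rfl⟩ _ ⟨j, rfl⟩
    exact congrArg Subtype.val ((ha i j).inv_right)
  have : IsMulCommutative (StarAlgebra.adjoin ℂ s) :=
    StarAlgebra.isMulCommutative_adjoin ℂ hcomm hcomm_star
  let B : StarSubalgebra ℂ A := (StarAlgebra.adjoin ℂ s).topologicalClosure
  have hB : IsClosed (B : Set A) := (StarAlgebra.adjoin ℂ s).isClosed_topologicalClosure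
  let _ : CommRing B := (StarAlgebra.adjoin ℂ s).commRingTopologicalClosure
    fun x y ↦ Subtype.ext (setLike_mul_comm x.2 y.2)
  let _ : CommCStarAlgebra B := { }
  have hmem (j : ι) : (a j : A) ∈ B :=
    StarSubalgebra.le_topologicalClosure _ (StarAlgebra.subset_adjoin ℂ s ⟨j, rfl⟩)
  let b (j : ι) : B := ⟨a j, hmem j⟩
  have hb (j : ι) : star (b j) * b j = 1 := Subtype.ext (Unitary.coe_star_mul_self (a j))
  have hnorm (φ : WeakDual.characterSpace ℂ B) (j : ι) : φ (b j) ∈ Submonoid.unitSphere ℂ := by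
    have h : star (φ (b j)) * φ (b j) = 1 := by
      rw [← map_star, ← map_mul, hb, map_one]
    rw [Submonoid.unitSphere, Submonoid.mem_mk, Subsemigroup.mem_mk, mem_sphere_zero_iff_norm]
    have h2 := congrArg norm h
    rw [CStarRing.norm_star_mul_self, norm_one] at h2
    nlinarith [norm_nonneg (φ (b j))]
  -- A character of `B` sends each unitary generator to the circle, so evaluation on the generators
  -- maps the spectrum to the torus. Pulling back along `p` and inverting the Gelfand transform
  -- gives `π`; `p` need not be onto.
  let p : C(WeakDual.characterSpace ℂ B, ι → Circle) :=
    ⟨fun φ j ↦ ⟨φ (b j), hnorm φ j⟩, continuous_pi fun j ↦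
      (map_continuous (WeakDual.gelfandTransform ℂ B (b j))).subtype_mk _⟩
  refine ⟨(B.subtype.comp (gelfandStarTransform B).symm.toStarAlgHom).comp
    (p.compStarAlgHom' ℂ ℂ), fun j ↦ ?_⟩
  have : p.compStarAlgHom' ℂ ℂ ⟨fun z ↦ (z j : ℂ), by fun_prop⟩ = gelfandStarTransform B (b j) :=
    ContinuousMap.ext fun φ ↦ rfl
  change ((gelfandStarTransform B).symm (p.compStarAlgHom' ℂ ℂ _) : A) = a j
  rw [this, StarAlgEquiv.symm_apply_apply]

/-! ### Measures of vector states -/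

section Representation

variable {X : Type*} [TopologicalSpace X] [CompactSpace X] [MeasurableSpace X]
  {H : Type*} [NormedAddCommGroup H] [InnerProductSpace ℂ H] [CompleteSpace H]

/-- A vector state of a representation of `C(X, ℂ)` is given by a finite measure on `X`. -/
theorem exists_measure_integral_eq_inner [T2Space X] [BorelSpace X]
    (π : C(X, ℂ) →⋆ₐ[ℂ] (H →L[ℂ] H)) (x : H) :
    ∃ μ : Measure X, IsFiniteMeasure μ ∧ ∀ f : C(X, ℂ), ∫ t, f t ∂μ = ⟪x, π f x⟫_ℂ := by
  let c : C(ℝ, ℂ) := ⟨fun r ↦ (r : ℂ), Complex.continuous_ofReal⟩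
  -- Taking real parts loses nothing: `π` sends real functions to self-adjoint operators (see
  -- `hreal`).
  let Λ₀ : CompactlySupportedContinuousMap X ℝ →ₗ[ℝ] ℝ :=
    { toFun f := (⟪x, π (c.comp (f : C(X, ℝ))) x⟫_ℂ).re
      map_add' f g := by
        have : c.comp ((f + g : CompactlySupportedContinuousMap X ℝ) : C(X, ℝ)) =
            c.comp (f : C(X, ℝ)) + c.comp (g : C(X, ℝ)) := by
          ext t; simp [c]
        rw [this, map_add, _root_.add_apply, inner_add_right, Complex.add_re]
      map_smul' r f := by
        have : c.comp ((r • f : CompactlySupportedContinuousMap X ℝ) : C(X, ℝ)) =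
            (r : ℂ) • c.comp (f : C(X, ℝ)) := by
          ext t; simp [c]
        rw [this, map_smul, _root_.smul_apply, inner_smul_right, Complex.re_ofReal_mul]
        rfl }
  have hpos (f : CompactlySupportedContinuousMap X ℝ) (hf : 0 ≤ f) : 0 ≤ Λ₀ f := by
    -- With f = g* g, the value at f becomes ‖π(g)x‖².
    let g : C(X, ℂ) := ⟨fun t ↦ (Real.sqrt (f t) : ℂ), by fun_prop⟩
    have hg : c.comp (f : C(X, ℝ)) = star g * g := by
      ext t
      simp only [c, g, ContinuousMap.comp_apply, ContinuousMap.coe_mk, ContinuousMap.mul_apply,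
        ContinuousMap.star_apply, RCLike.star_def, Complex.conj_ofReal]
      rw [← Complex.ofReal_mul, Real.mul_self_sqrt (hf t)]
    change 0 ≤ (⟪x, π (c.comp (f : C(X, ℝ))) x⟫_ℂ).re
    rw [hg, map_mul, map_star, ContinuousLinearMap.star_eq_adjoint, mul_apply_eq_comp,
      ContinuousLinearMap.adjoint_inner_right]
    exact inner_self_nonneg (𝕜 := ℂ)
  let Λ : CompactlySupportedContinuousMap X ℝ →ₚ[ℝ] ℝ := PositiveLinearMap.mk₀ Λ₀ hpos
  refine ⟨RealRMK.rieszMeasure Λ, inferInstance, fun f ↦ ?_⟩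
  have hreal (g : C(X, ℝ)) :
      ((∫ t, g t ∂(RealRMK.rieszMeasure Λ) : ℝ) : ℂ) = ⟪x, π (c.comp g) x⟫_ℂ := by
    have h1 := RealRMK.integral_rieszMeasure Λ
      (CompactlySupportedContinuousMap.continuousMapEquiv g)
    have h2 : ∫ t, g t ∂(RealRMK.rieszMeasure Λ) = (⟪x, π (c.comp g) x⟫_ℂ).re := h1
    have h3 : star (c.comp g) = c.comp g := by ext t; simp [c]
    rw [h2]
    refine Complex.conj_eq_iff_re.mp ?_
    rw [inner_conj_symm, ← ContinuousLinearMap.adjoint_inner_right,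
      ← ContinuousLinearMap.star_eq_adjoint, ← map_star, h3]
  let u : C(X, ℝ) := ⟨fun t ↦ (f t).re, by fun_prop⟩
  let v : C(X, ℝ) := ⟨fun t ↦ (f t).im, by fun_prop⟩
  have hf : f = c.comp u + Complex.I • c.comp v := by
    ext t
    simp only [c, u, v, ContinuousMap.add_apply, ContinuousMap.comp_apply, ContinuousMap.coe_mk,
      ContinuousMap.smul_apply, smul_eq_mul]
    rw [mul_comm, Complex.re_add_im]
  have hint : Integrable f (RealRMK.rieszMeasure Λ) :=
    (BoundedContinuousFunction.mkOfCompact f).integrable _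
  rw [hf, map_add, map_smul, _root_.add_apply, _root_.smul_apply,
    inner_add_right, inner_smul_right, ← hreal, ← hreal, ← hf]
  rw [← integral_re_add_im hint, mul_comm Complex.I]
  rfl

end Representation

/-- Since ⟪π(f)x, π(g)x⟫ = ⟪x, π(f* g)x⟫, norms and limits of vectors π(f)x can be computed as
integrals. -/
theorem inner_apply_apply_of_integral_eq_inner {X : Type*} [TopologicalSpace X] [MeasurableSpace X]
    {H : Type*} [NormedAddCommGroup H] [InnerProductSpace ℂ H] [CompleteSpace H]
    {π : C(X, ℂ) →⋆ₐ[ℂ] (H →L[ℂ] H)} {x : H} {μ : Measure X}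
    (hμ : ∀ f : C(X, ℂ), ∫ t, f t ∂μ = ⟪x, π f x⟫_ℂ) (f g : C(X, ℂ)) :
    ⟪π f x, π g x⟫_ℂ = ∫ t, star (f t) * g t ∂μ := by
  have h := hμ (star f * g)
  simp only [ContinuousMap.mul_apply, ContinuousMap.star_apply] at h
  rw [h, map_mul, map_star, ContinuousLinearMap.star_eq_adjoint, mul_apply_eq_comp,
    ContinuousLinearMap.adjoint_inner_right]

/-! ### Point masses and joint eigenvectors -/

/-- The powers of a function that peaks at `z` single out the mass of `z`. -/
theorem tendsto_integral_mul_peak_pow {X : Type*} [MetricSpace X] [CompactSpace X]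
    [MeasurableSpace X] [BorelSpace X] (μ : Measure X) [IsFiniteMeasure μ] (z : X) (h : C(X, ℂ)) :
    Tendsto (fun n : ℕ ↦ ∫ t, h t * (((1 + dist t z)⁻¹ : ℝ) : ℂ) ^ n ∂μ) atTop
      (𝓝 (h z * μ.real {z})) := by
  have hlim : ∫ t, Set.indicator {z} (fun _ ↦ h z) t ∂μ = h z * μ.real {z} := by
    rw [integral_indicator (measurableSet_singleton z), setIntegral_const, Complex.real_smul,
      mul_comm]
  rw [← hlim]
  have hcont : Continuous fun t ↦ (1 + dist t z)⁻¹ :=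
    (by fun_prop : Continuous fun t ↦ 1 + dist t z).inv₀ fun t ↦ by positivity
  refine tendsto_integral_of_dominated_convergence (fun _ ↦ ‖h‖) (fun n ↦ ?_)
    (integrable_const _) (fun n ↦ ae_of_all _ fun t ↦ ?_) (ae_of_all _ fun t ↦ ?_)
  · exact Continuous.aestronglyMeasurable (by fun_prop)
  · rw [norm_mul, norm_pow, Complex.norm_real, Real.norm_of_nonneg (by positivity)]
    refine (mul_le_of_le_one_right (norm_nonneg _) (pow_le_one₀ (by positivity) ?_)).trans
      (h.norm_coe_le_norm t)
    exact inv_le_one_of_one_le₀ (by linarith [dist_nonneg (x := t) (y := z)])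
  · by_cases ht : t = z
    · simp [ht]
    · rw [Set.indicator_of_notMem (by simpa using ht)]
      have h1 : Tendsto (fun n : ℕ ↦ (((1 + dist t z)⁻¹ : ℝ) : ℂ) ^ n) atTop (𝓝 0) := by
        apply tendsto_pow_atTop_nhds_zero_of_norm_lt_one
        rw [Complex.norm_real, Real.norm_of_nonneg (by positivity)]
        exact inv_lt_one_of_one_lt₀ (by linarith [dist_pos.mpr ht])
      simpa using h1.const_mul (h t)

/-- A point mass of the spectral measure of a vector `x` is the inner product of `x` with a joint
eigenvector. -/
theorem exists_eigenvector_inner_eq_measure_singleton {X : Type*} [MetricSpace X] [CompactSpace X]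
    [MeasurableSpace X] [BorelSpace X]
    {H : Type*} [NormedAddCommGroup H] [InnerProductSpace ℂ H] [CompleteSpace H]
    {π : C(X, ℂ) →⋆ₐ[ℂ] (H →L[ℂ] H)} {x : H} {μ : Measure X} [IsFiniteMeasure μ]
    (hμ : ∀ f : C(X, ℂ), ∫ t, f t ∂μ = ⟪x, π f x⟫_ℂ) (z : X) :
    ∃ y : H, (∀ h : C(X, ℂ), π h y = h z • y) ∧ ⟪x, y⟫_ℂ = μ.real {z} := by
  have hcont : Continuous fun t ↦ (1 + dist t z)⁻¹ :=
    (by fun_prop : Continuous fun t ↦ 1 + dist t z).inv₀ fun t ↦ by positivity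
  let g : C(X, ℂ) := ⟨fun t ↦ (((1 + dist t z)⁻¹ : ℝ) : ℂ), by fun_prop⟩
  let u (n : ℕ) : H := π (g ^ n) x
  let A (n : ℕ) : ℂ := ∫ t, g t ^ n ∂μ
  have hA : Tendsto A atTop (𝓝 (μ.real {z})) := by
    have h := tendsto_integral_mul_peak_pow μ z 1
    simp only [ContinuousMap.one_apply, one_mul] at h
    exact h
  have hgstar (t : X) : star (g t) = g t := Complex.conj_ofReal _
  have hinner (n m : ℕ) : ⟪u n, u m⟫_ℂ = A (n + m) := by
    rw [inner_apply_apply_of_integral_eq_inner hμ]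
    simp only [ContinuousMap.pow_apply, star_pow, hgstar, ← pow_add, A]
  have hcauchy : CauchySeq u := by
    rw [Metric.cauchySeq_iff]
    intro ε hε
    -- The coefficients 1, −2, 1 in `hsq` cancel the limit of `A` and leave at most four errors,
    -- each below ε²/4.
    obtain ⟨N, hN⟩ := Metric.tendsto_atTop.mp hA (ε ^ 2 / 4) (by positivity)
    have hN' (k : ℕ) (hk : N ≤ k) : |(A k).re - μ.real {z}| < ε ^ 2 / 4 := by
      refine lt_of_le_of_lt ?_ (hN k hk)
      rw [dist_eq_norm]
      simpa using Complex.abs_re_le_norm (A k - μ.real {z})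
    refine ⟨N, fun m hm n hn ↦ ?_⟩
    have hsq : ‖u m - u n‖ ^ 2 = (A (m + m)).re - 2 * (A (m + n)).re + (A (n + n)).re := by
      rw [norm_sub_sq (𝕜 := ℂ), ← inner_self_eq_norm_sq (𝕜 := ℂ), ← inner_self_eq_norm_sq (𝕜 := ℂ),
        hinner, hinner, hinner]
      rfl
    have h1 := abs_lt.mp (hN' (m + m) (by omega))
    have h2 := abs_lt.mp (hN' (m + n) (by omega))
    have h3 := abs_lt.mp (hN' (n + n) (by omega))
    rw [dist_eq_norm]
    exact lt_of_pow_lt_pow_left₀ 2 hε.le (by rw [hsq]; linarith)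
  obtain ⟨y, hy⟩ := cauchySeq_tendsto_of_complete hcauchy
  refine ⟨y, fun h ↦ ?_, ?_⟩
  · let k : C(X, ℂ) := h - algebraMap ℂ C(X, ℂ) (h z)
    have hk : π k y = π h y - h z • y := by
      rw [map_sub, AlgHomClass.commutes, Algebra.algebraMap_eq_smul_one]
      rfl
    have hkz : k z = 0 := by simp [k]
    have hsq (n : ℕ) : ((‖π k (u n)‖ ^ 2 : ℝ) : ℂ) = ∫ t, (star k * k) t * g t ^ (n * 2) ∂μ := by
      have h1 : π k (u n) = π (k * g ^ n) x := by rw [map_mul]; rfl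
      rw [h1, Complex.ofReal_pow]
      rw [← Complex.coe_algebraMap, ← inner_self_eq_norm_sq_to_K,
        inner_apply_apply_of_integral_eq_inner hμ]
      refine integral_congr_ae (ae_of_all _ fun t ↦ ?_)
      simp only [ContinuousMap.mul_apply, ContinuousMap.star_apply, ContinuousMap.pow_apply,
        star_mul', star_pow, hgstar]
      ring
    have hlim : Tendsto (fun n ↦ ((‖π k (u n)‖ ^ 2 : ℝ) : ℂ)) atTop (𝓝 ((0 : ℝ) : ℂ)) := by
      have h1 := (tendsto_integral_mul_peak_pow μ z (star k * k)).comp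
        (tendsto_id.atTop_mul_const' (by norm_num : 0 < 2))
      simp only [ContinuousMap.mul_apply, hkz, mul_zero, zero_mul] at h1
      simp only [hsq, Complex.ofReal_zero]
      exact h1
    have hlim' : Tendsto (fun n ↦ ‖π k (u n)‖ ^ 2) atTop (𝓝 0) :=
      (Complex.continuous_re.tendsto _).comp hlim
    have hlim2 : Tendsto (fun n ↦ ‖π k (u n)‖ ^ 2) atTop (𝓝 (‖π k y‖ ^ 2)) :=
      (((π k).continuous.tendsto y).comp hy).norm.pow 2
    have h0 : ‖π k y‖ ^ 2 = 0 := tendsto_nhds_unique hlim2 hlim'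
    rw [← sub_eq_zero, ← hk]
    simpa using h0
  · refine tendsto_nhds_unique ((continuous_const.inner continuous_id).tendsto y |>.comp hy) ?_
    refine hA.congr fun n ↦ ?_
    simpa [u] using (hinner 0 n).symm

/-! ### Uniqueness from Fourier coefficients -/

theorem continuous_prod_zpow_circle {ι : Type*} [Fintype ι] (m : ι → ℤ) :
    Continuous fun z : ι → Circle ↦ ∏ j, (z j : ℂ) ^ m j :=
  continuous_finsetProd _ fun j _ ↦ (by fun_prop : Continuous fun z : ι → Circle ↦ (z j : ℂ)).zpow₀
    _ fun z ↦ Or.inl (z j).coe_ne_zero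

/-- A finite measure on the torus is determined by its Fourier coefficients. -/
theorem ext_of_integral_prod_zpow_eq {ι : Type*} [Fintype ι] {σ σ' : Measure (ι → Circle)}
    [IsFiniteMeasure σ] [IsFiniteMeasure σ']
    (h : ∀ m : ι → ℤ, ∫ z : ι → Circle, ∏ j, (z j : ℂ) ^ m j ∂σ =
      ∫ z : ι → Circle, ∏ j, (z j : ℂ) ^ m j ∂σ') : σ = σ' := by
  classical
  let e (m : ι → ℤ) : C(ι → Circle, ℂ) := ⟨_, continuous_prod_zpow_circle m⟩
  have he (m : ι → ℤ) (z : ι → Circle) : e m z = ∏ j, (z j : ℂ) ^ m j := rfl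
  have hadd (m n : ι → ℤ) : e (m + n) = e m * e n := by
    ext z
    simp only [he, ContinuousMap.mul_apply, ← Finset.prod_mul_distrib, Pi.add_apply,
      zpow_add₀ (Circle.coe_ne_zero _)]
  have hneg (m : ι → ℤ) : e (-m) = star (e m) := by
    ext z
    simp only [he, ContinuousMap.star_apply, star_prod, star_zpow₀, RCLike.star_def,
      ← Circle.coe_inv_eq_conj, Circle.coe_inv, inv_zpow', Pi.neg_apply]
  let eq := BoundedContinuousFunction.mkOfCompact (α := ι → Circle) (β := ℂ)
  let A : StarSubalgebra ℂ (BoundedContinuousFunction (ι → Circle) ℂ) :=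
    StarAlgebra.adjoin ℂ (Set.range fun m ↦ eq (e m))
  refine ext_of_forall_mem_subalgebra_integral_eq_of_polish (A := A) ?_ ?_
  · intro z w hzw
    obtain ⟨j, hj⟩ := Function.ne_iff.mp hzw
    refine ⟨_, ⟨_, ⟨eq (e (Pi.single j 1)), StarAlgebra.subset_adjoin ℂ _ ⟨_, rfl⟩, rfl⟩, rfl⟩, ?_⟩
    have hval (z : ι → Circle) : e (Pi.single j 1) z = z j := by
      rw [he, Finset.prod_eq_single j (fun i _ hi ↦ by simp [hi]) (by simp)]
      simp
    change e (Pi.single j 1) z ≠ e (Pi.single j 1) w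
    rw [hval, hval]
    exact fun hc ↦ hj (Circle.ext hc)
  · intro f hf
    -- The monomials are closed under products and conjugation, so the star algebra they generate is
    -- just their linear span.
    have hspan : f ∈ Submodule.span ℂ (Set.range fun m ↦ eq (e m)) := by
      have hstar : Set.range (fun m ↦ eq (e m)) ∪ star (Set.range fun m ↦ eq (e m)) =
          Set.range fun m ↦ eq (e m) := by
        refine Set.union_eq_left.mpr ?_
        rintro g ⟨m, hm⟩
        refine ⟨-m, ?_⟩
        rw [← star_star g, ← hm]
        ext z
        exact DFunLike.congr_fun (hneg m) z
      have hf' : f ∈ Subalgebra.toSubmodule A.toSubalgebra := hf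
      rw [StarAlgebra.adjoin_eq_span, hstar] at hf'
      refine Submodule.span_mono ?_ hf'
      intro g hg
      induction hg using Submonoid.closure_induction with
      | mem g hg => exact hg
      | one => exact ⟨0, by ext z; exact (he 0 z).trans (by simp)⟩
      | mul f g _ _ hf hg =>
        obtain ⟨m, rfl⟩ := hf
        obtain ⟨n, rfl⟩ := hg
        exact ⟨m + n, by ext z; exact DFunLike.congr_fun (hadd m n) z⟩
    clear hf
    induction hspan using Submodule.span_induction with
    | mem f hf =>
      obtain ⟨m, rfl⟩ := hf
      change ∫ z, e m z ∂σ = ∫ z, e m z ∂σ'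
      simp only [he, h m]
    | zero => simp
    | add f g _ _ hf hg =>
      simp only [BoundedContinuousFunction.add_apply]
      rw [integral_add (f.integrable σ) (g.integrable σ),
        integral_add (f.integrable σ') (g.integrable σ'), hf, hg]
    | smul c f _ hf =>
      simp only [BoundedContinuousFunction.coe_smul]
      rw [integral_smul, integral_smul, hf]

/-! ### Application to the dynamical system -/

namespace TracePreservingSystem

variable {M : Type*} [CStarAlgebra M] [PartialOrder M] [StarOrderedRing M] [WStarAlgebra M]
  {d : ℕ} (S : TracePreservingSystem M d)

theorem U_commute (i j : Fin d) : Commute (S.U i) (S.U j) := by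
  refine LinearIsometryEquiv.ext fun x ↦ ?_
  change S.U i (S.U j x) = S.U j (S.U i x)
  refine S.denseRange_toL2.induction_on x (isClosed_eq (by fun_prop) (by fun_prop)) fun a ↦ ?_
  simp only [U_toL2, S.T_comm]

/-- The representation of `C(𝕋 ^ d, ℂ)` on `L₂(M, τ)` that sends the `j`-th coordinate to the
inverse of `T j`. -/
theorem exists_starAlgHom_torus : ∃ π : C(Fin d → Circle, ℂ) →⋆ₐ[ℂ] (S.L2 →L[ℂ] S.L2),
    (∀ j x, π ⟨fun z ↦ (z j : ℂ), by fun_prop⟩ x = (S.U j)⁻¹ x) ∧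
    ∀ m x y, ⟪x, π ⟨_, continuous_prod_zpow_circle m⟩ y⟫_ℂ = ⟪S.Upow m x, y⟫_ℂ := by
  let L : unitary (S.L2 →L[ℂ] S.L2) ≃* (S.L2 ≃ₗᵢ[ℂ] S.L2) := Unitary.linearIsometryEquiv
  -- Inverses are needed because ⟪T^m x, y⟫ = ⟪x, T^(−m) y⟫, so z^m must act as T^(−m).
  obtain ⟨π, hπ⟩ := exists_starAlgHom_of_commute_unitary (fun j ↦ L.symm (S.U j)⁻¹)
    fun i j ↦ ((S.U_commute i j).inv_inv).map L.symm
  refine ⟨π, fun j x ↦ by rw [hπ]; rfl, fun m x y ↦ ?_⟩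
  let u (j : Fin d) : unitary C(Fin d → Circle, ℂ) :=
    ⟨⟨fun z ↦ (z j : ℂ), by fun_prop⟩, by
      rw [Unitary.mem_iff_star_mul_self]
      ext z
      change starRingEnd ℂ (z j : ℂ) * (z j : ℂ) = 1
      rw [← Circle.coe_inv_eq_conj, ← Circle.coe_mul, inv_mul_cancel, Circle.coe_one]⟩
  let Φ : unitary C(Fin d → Circle, ℂ) →* (S.L2 ≃ₗᵢ[ℂ] S.L2) :=
    L.toMonoidHom.comp
      (Unitary.map ⟨⟨⟨π, map_one π⟩, map_mul π⟩, map_star π⟩).toMonoidHom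
  have hΦu (j : Fin d) : Φ (u j) = (S.U j)⁻¹ := by
    refine L.symm.injective (Subtype.ext ?_)
    exact hπ j
  -- `v` is the monomial z^(−m), which `Φ` sends to T^m; its star is z^m, and taking adjoints moves
  -- T^m to the left of the inner product.
  let v : unitary C(Fin d → Circle, ℂ) := (List.ofFn fun j ↦ (u j)⁻¹ ^ m j).prod
  have hΦv : Φ v = S.Upow m := by
    rw [map_list_prod, List.map_ofFn]
    refine congrArg (fun f ↦ (List.ofFn f).prod) (funext fun j ↦ ?_)
    rw [Function.comp_apply, map_zpow, map_inv, hΦu, inv_inv]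
  have hv : star (v : C(Fin d → Circle, ℂ)) = ⟨_, continuous_prod_zpow_circle m⟩ := by
    ext z
    let E : unitary C(Fin d → Circle, ℂ) →* ℂ :=
      (ContinuousMap.evalAlgHom ℂ ℂ z : C(Fin d → Circle, ℂ) →* ℂ).comp (unitary _).subtype
    have hE (j : Fin d) : E (u j) = z j := rfl
    change E v⁻¹ = ∏ j, (z j : ℂ) ^ m j
    rw [map_inv, map_list_prod, List.map_ofFn, List.prod_ofFn, ← Finset.prod_inv_distrib]
    refine Finset.prod_congr rfl fun j _ ↦ ?_
    rw [Function.comp_apply, map_zpow, map_inv, hE, inv_zpow, inv_inv]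
  rw [← hv, ← hΦv, map_star, ContinuousLinearMap.star_eq_adjoint,
    ContinuousLinearMap.adjoint_inner_right]
  rfl

end TracePreservingSystem

theorem mainTheorem9 {M : Type*} [CStarAlgebra M] [PartialOrder M] [StarOrderedRing M]
    [WStarAlgebra M] {d : ℕ} (S : TracePreservingSystem M d)
    (x : S.L2) (hx : x ∈ S.kroneckerᗮ) :
    ∃ σ : MeasureTheory.Measure (Fin d → Circle),
      S.IsSpectralMeasure x σ ∧
      (∀ σ' : MeasureTheory.Measure (Fin d → Circle), S.IsSpectralMeasure x σ' → σ' = σ) ∧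
      ∀ z : Fin d → Circle, σ {z} = 0 := by
  obtain ⟨π, hU, hπ⟩ := S.exists_starAlgHom_torus
  obtain ⟨σ, hfin, hσ⟩ := exists_measure_integral_eq_inner π x
  have hspec : S.IsSpectralMeasure x σ := ⟨hfin, fun m ↦ (hσ _).trans (hπ m x x)⟩
  refine ⟨σ, hspec, fun σ' h' ↦ ?_, fun z ↦ ?_⟩
  · have := h'.finite
    exact ext_of_integral_prod_zpow_eq fun m ↦ (h'.fourier m).trans (hspec.fourier m).symm
  · obtain ⟨y, hy, hxy⟩ := exists_eigenvector_inner_eq_measure_singleton hσ z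
    have hmem : y ∈ S.kronecker := by
      refine Submodule.le_topologicalClosure _ (Submodule.subset_span (Set.mem_iInter.mpr ?_))
      -- The coordinate z_j acts as the inverse of `S.U j`, hence the inverse eigenvalue.
      refine fun j ↦ ⟨(z j)⁻¹, ?_⟩
      have h1 : (S.U j)⁻¹ y = (z j : ℂ) • y := (hU j y).symm.trans (hy _)
      have h2 : y = (z j : ℂ) • S.U j y := by
        rw [← map_smul, ← h1]
        exact ((S.U j).apply_symm_apply y).symm
      nth_rw 2 [h2]
      rw [Circle.coe_inv, inv_smul_smul₀ (Circle.coe_ne_zero _)]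
    have h0 : ((σ.real {z} : ℝ) : ℂ) = 0 :=
      hxy.symm.trans (Submodule.inner_left_of_mem_orthogonal hmem hx)
    exact (measureReal_eq_zero_iff).mp (Complex.ofReal_eq_zero.mp h0)
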